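/- For $n\ge 0$ and $q\in\mathbb{R}$ let $A_n(x;q)$ be the Foata–Schützenberger $q$-Eulerian polynomial, defined by $$A_0(x;q)=1,\qquad A_n(x;q)=\sum_{\pi\in S_n}x^{\mathrm{exc}(\pi)}q^{c(\pi)}\quad(n\ge 1),$$ where $\mathrm{exc}(\pi)$ is the number of indices $i$ with $\pi(i)>i$ and $c(\pi)$ is the number of cycles of $\pi$, fixed points included. Let $q\in\mathbb{R}$ and let $n\ge 0$ be an integer. (a) If $q>0$ and $n\ge 2$, then all complex zeros of $A_n(x;q)$ are real, nonpositive and simple. (b) If $n+q\le 0$ and $q\ne 0$, then all complex zeros of $A_{n+1}(x;q)$ are real and lie in $[1,\infty)$. (c) If $q$ is a negative integer, then all complex zeros of $A_n(x;q)$ are real and lie in $[1,\infty)$, and $(x-1)^m$ divides $A_n(x;q)$ while $(x-1)^{m+1}$ does not, where $m=\max\{n+q,0\}$. In particular, $A_n(x;-1)=-(x-1)^{n-1}$ for $n\ge 1$. (A nonzero constant polynomial has no zeros and satisfies the assertions about zeros vacuously.) -/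

import Mathlib

open Polynomial

/-- The number of excedances of a permutation, i.e. of indices `i` with `π i > i`. -/
def excedances {n : ℕ} (π : Equiv.Perm (Fin n)) : ℕ :=
  (Finset.univ.filter fun i : Fin n => i < π i).card

/-- The number of cycles of a permutation, fixed points included: the number of cycles of
length at least two in its disjoint cycle decomposition plus the number of fixed points. -/
def cycleNumber {n : ℕ} (π : Equiv.Perm (Fin n)) : ℕ :=
  π.cycleFactorsFinset.card + (Finset.univ.filter fun i : Fin n => π i = i).card

/-- The `q`-Eulerian polynomial of Foata and Schützenberger, the sum over all permutations `π` of
`n` letters of `q ^ c(π) * x ^ exc(π)`. For `n = 0` the only permutation contributes `1`. -/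
noncomputable def qEulerian (n : ℕ) (q : ℝ) : ℝ[X] :=
  ∑ π : Equiv.Perm (Fin n), C (q ^ cycleNumber π) * X ^ excedances π

/-- `RZ p I`: all complex zeros of the real polynomial `p` are real and lie in `I`.
(A nonzero constant satisfies this for every `I`, the zero polynomial for none.) -/
def RZ (p : ℝ[X]) (I : Set ℝ) : Prop :=
  ∀ z : ℂ, aeval z p = 0 → ∃ x ∈ I, z = (x : ℂ)

/-!
Inserting a letter into the cycles of a permutation gives the recurrence
`A_{n+1} = (n x + q) A_n + x (1 - x) A_n'`. At a zero of `A_{n+1}` that is not a zero of `A_n`,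
division by `A_n` and by `x` (for `q > 0`) or by `1 - x` (for `n + q ≤ 0`) turns the recurrence
into an equation between a partial fraction with nonnegative residues, whose poles are the zeros
of `A_n` and `0` or `1`, and a nonzero real constant. Such a partial fraction maps the open upper
half plane to the closed lower one and is real off the real axis only where it vanishes, so the
zero is real; on the real line signs locate it. For `q > 0`, simplicity follows because
`(A_{n+1} / (x A_n))' = -q / x ^ 2 - ((x - 1) A_n' / A_n)' < 0` off the zeros of `x A_n`, where
the last derivative is nonnegative because the zeros of `A_n` lie to the left of `1`.

For `q = -k` a negative integer, `A_k` has all its zeros in `(1, ∞)`, and each further step of the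
recurrence splits off a factor `x - 1` and applies `k - x d/dx` to the cofactor. This operator
keeps the zeros in `(1, ∞)`, by the same partial fraction argument.
-/

section Cycles

open Equiv Perm

variable {α β : Type*}

theorem sameCycle_map {σ : Perm α} {τ : Perm β} {f : α → β}
    (hf : ∀ a, τ.SameCycle (f (σ a)) (f a)) {a b : α} (h : σ.SameCycle a b) :
    τ.SameCycle (f a) (f b) := by
  obtain ⟨k, rfl⟩ := h
  induction k with
  | zero => rfl
  | succ k ih =>
    rw [add_comm, zpow_one_add, mul_apply]
    exact ih.trans (hf _).symm
  | pred k ih =>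
    refine ih.trans ?_
    simpa only [← mul_apply, ← zpow_one_add, add_sub_cancel] using
      hf ((σ ^ (-(k : ℤ) - 1)) a)

theorem natCard_quotient_sameCycle_congr {σ : Perm α} {τ : Perm β} (f : α → β) (g : β → α)
    (hf : ∀ a, τ.SameCycle (f (σ a)) (f a)) (hg : ∀ b, σ.SameCycle (g (τ b)) (g b))
    (hgf : ∀ a, σ.SameCycle (g (f a)) a) (hfg : ∀ b, τ.SameCycle (f (g b)) b) :
    Nat.card (Quotient (SameCycle.setoid σ)) = Nat.card (Quotient (SameCycle.setoid τ)) :=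
  Nat.card_congr
    { toFun := Quotient.map f fun _ _ => sameCycle_map hf
      invFun := Quotient.map g fun _ _ => sameCycle_map hg
      left_inv := by rintro ⟨a⟩; exact Quotient.sound (hgf a)
      right_inv := by rintro ⟨b⟩; exact Quotient.sound (hfg b) }

variable [Fintype α] [DecidableEq α]

/-- A label telling apart the cycles of `σ`, fixed points included: the cycle factor through `x`
if `x` is moved, and `x` itself if it is fixed (where `σ.cycleOf x = 1` is uninformative). -/
def cycleLabel (σ : Perm α) (x : α) : Perm α ⊕ α :=
  if σ x = x then .inr x else .inl (σ.cycleOf x)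

theorem cycleLabel_eq_cycleLabel_iff {σ : Perm α} {x y : α} :
    cycleLabel σ x = cycleLabel σ y ↔ σ.SameCycle x y := by
  by_cases hx : σ x = x <;> by_cases hy : σ y = y
  · simp only [cycleLabel, hx, hy, if_true, Sum.inr.injEq]
    exact ⟨fun h => h ▸ SameCycle.refl σ x, fun h => h.eq_of_left hx⟩
  · simpa [cycleLabel, hx, hy] using fun h : σ.SameCycle x y => hy (h.apply_eq_self_iff.1 hx)
  · simpa [cycleLabel, hx, hy] using fun h : σ.SameCycle x y => hx (h.apply_eq_self_iff.2 hy)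
  · simpa [cycleLabel, hx, hy] using
      (sameCycle_iff_cycleOf_eq_of_mem_support (mem_support.2 hx) (mem_support.2 hy)).symm

theorem image_cycleLabel (σ : Perm α) :
    Finset.univ.image (cycleLabel σ) =
      σ.cycleFactorsFinset.disjSum (Finset.univ.filter fun x => σ x = x) := by
  ext (c | x)
  · simp only [Finset.mem_image, Finset.mem_univ, true_and, Finset.inl_mem_disjSum]
    constructor
    · rintro ⟨x, hx⟩
      by_cases h : σ x = x <;> simp only [cycleLabel, h, if_true, if_false, reduceCtorEq,
        Sum.inl.injEq] at hx
      exact hx ▸ cycleOf_mem_cycleFactorsFinset_iff.2 (mem_support.2 h)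
    · intro hc
      obtain ⟨x, hx⟩ := (mem_cycleFactorsFinset_iff.1 hc).1.nonempty_support
      have hσx : σ x ≠ x := mem_support.1 (mem_cycleFactorsFinset_support_le hc hx)
      exact ⟨x, by simp [cycleLabel, hσx, cycle_is_cycleOf hx hc]⟩
  · simp only [Finset.mem_image, Finset.mem_univ, true_and, Finset.inr_mem_disjSum,
      Finset.mem_filter_univ]
    constructor
    · rintro ⟨y, hy⟩
      by_cases h : σ y = y <;> simp_all [cycleLabel]
    · exact fun h => ⟨x, by simp [cycleLabel, h]⟩

theorem natCard_quotient_sameCycle (σ : Perm α) :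
    Nat.card (Quotient (SameCycle.setoid σ)) =
      σ.cycleFactorsFinset.card + (Finset.univ.filter fun x => σ x = x).card := by
  have hker : SameCycle.setoid σ = Setoid.ker (cycleLabel σ) :=
    Setoid.ext fun _ _ => cycleLabel_eq_cycleLabel_iff.symm
  rw [hker, Nat.card_congr (Setoid.quotientKerEquivRange _), ← Set.image_univ,
    ← Finset.coe_univ, ← Finset.coe_image, image_cycleLabel, Nat.card_eq_card_toFinset,
    Finset.toFinset_coe, Finset.card_disjSum]

end Cycles

section Insertion

open Equiv Perm

variable {n : ℕ} (e : Perm (Fin n))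

theorem decomposeFin_symm_zero_eq_extendDomain :
    decomposeFin.symm (0, e) = e.extendDomain (finSuccAboveEquiv 0) := by
  ext i
  refine Fin.cases ?_ (fun i => ?_) i
  · simp [extendDomain_apply_not_subtype]
  · simpa [finSuccAboveEquiv_apply] using
      congrArg Fin.val (extendDomain_apply_image e (finSuccAboveEquiv 0) i).symm

theorem cycleNumber_decomposeFin_symm_zero :
    cycleNumber (decomposeFin.symm (0, e)) = cycleNumber e + 1 := by
  have hcycleType : (decomposeFin.symm (0, e)).cycleType = e.cycleType := by
    rw [decomposeFin_symm_zero_eq_extendDomain, cycleType_extendDomain]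
  have hfactors : (decomposeFin.symm (0, e)).cycleFactorsFinset.card =
      e.cycleFactorsFinset.card := by
    have := congrArg Multiset.card hcycleType
    rwa [cycleType_def, cycleType_def, Multiset.card_map, Multiset.card_map] at this
  simp [cycleNumber, hfactors, Fin.card_filter_univ_succ, add_assoc]

theorem cycleNumber_decomposeFin_symm_succ (p : Fin n) :
    cycleNumber (decomposeFin.symm (p.succ, e)) = cycleNumber e := by
  rw [cycleNumber, cycleNumber, ← natCard_quotient_sameCycle, ← natCard_quotient_sameCycle]
  set σ := decomposeFin.symm (p.succ, e)
  have hσ_zero : σ 0 = p.succ := decomposeFin_symm_apply_zero _ _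
  have hσ_preimage : ∀ i, e i = p → σ i.succ = 0 := by rintro i rfl; simp [σ]
  have hσ_succ : ∀ i, e i ≠ p → σ i.succ = (e i).succ := fun i hi => by
    rw [decomposeFin_symm_apply_succ]
    exact swap_apply_of_ne_of_ne (Fin.succ_ne_zero _) (by simpa using hi)
  refine natCard_quotient_sameCycle_congr (Fin.cases p id) Fin.succ ?_ ?_ ?_ fun _ => .rfl
  · refine Fin.cases (by simp [hσ_zero, SameCycle.refl]) fun i => ?_
    by_cases hi : e i = p
    · simpa [hσ_preimage i hi, ← hi] using SameCycle.refl e i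
    · simpa [hσ_succ i hi] using SameCycle.refl e i
  · intro i
    by_cases hi : e i = p
    · rw [hi, ← hσ_zero, ← hσ_preimage i hi]
      simp [SameCycle.refl]
    · simp [← hσ_succ i hi, SameCycle.refl]
  · refine Fin.cases ?_ fun i => .rfl
    simp [← hσ_zero, SameCycle.refl]

theorem excedances_decomposeFin_symm_zero :
    excedances (decomposeFin.symm (0, e)) = excedances e := by
  simp [excedances, Fin.card_filter_univ_succ]

theorem excedances_decomposeFin_symm_succ (j : Fin n) :
    excedances (decomposeFin.symm ((e j).succ, e)) =
      if j < e j then excedances e else excedances e + 1 := by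
  set σ := decomposeFin.symm ((e j).succ, e)
  have hσ_succ (i : Fin n) : i.succ < σ i.succ ↔ i ≠ j ∧ i < e i := by
    by_cases hij : i = j
    · simp [σ, hij]
    · rw [decomposeFin_symm_apply_succ,
        swap_apply_of_ne_of_ne (Fin.succ_ne_zero _) (by simpa using hij)]
      simp [hij]
  have herase : (Finset.univ.filter fun i : Fin n => i.succ < σ i.succ) =
      (Finset.univ.filter fun i => i < e i).erase j := by
    ext i; simp [hσ_succ]
  have hσ_zero : 0 < σ 0 := by simp [σ]
  rw [excedances, Fin.card_filter_univ_succ, if_pos hσ_zero, herase]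
  split_ifs with hj
  · exact Finset.card_erase_add_one (by simpa using hj)
  · rw [Finset.erase_eq_of_notMem (by simpa using hj), excedances]

theorem excedances_le_pred (π : Perm (Fin n)) : excedances π ≤ n - 1 := by
  rcases n with _ | n
  · simp [excedances]
  · have hsubset : (Finset.univ.filter fun i => i < π i) ⊆ Finset.univ.erase (Fin.last n) := by
      intro i hi
      simpa using Fin.ne_last_of_lt (Finset.mem_filter.1 hi).2
    simpa [excedances] using Finset.card_le_card hsubset

end Insertion

section Recurrence

-- Multiplying by `f` avoids the truncated exponent `k - 1`.
theorem mul_derivative_pow {R : Type*} [CommSemiring R] (f : R[X]) (k : ℕ) :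
    f * derivative (f ^ k) = (k : R[X]) * f ^ k * derivative f := by
  rcases k with _ | k
  · simp
  · rw [derivative_pow_succ, map_add, map_natCast, map_one, pow_succ]
    push_cast
    ring

theorem sum_X_pow_excedances_decomposeFin_symm_succ {R : Type*} [CommRing R] {n : ℕ}
    (e : Equiv.Perm (Fin n)) :
    ∑ p : Fin n, (X : R[X]) ^ excedances (Equiv.Perm.decomposeFin.symm (p.succ, e)) =
      (excedances e : R[X]) * X ^ excedances e +
        ((n : R[X]) - (excedances e : R[X])) * X ^ (excedances e + 1) := by
  have hcard : excedances e + (Finset.univ.filter fun j : Fin n => ¬ j < e j).card = n := by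
    rw [excedances, Finset.card_filter_add_card_filter_not, Finset.card_fin]
  rw [← Equiv.sum_comp e]
  simp only [excedances_decomposeFin_symm_succ, apply_ite (X ^ · : ℕ → R[X])]
  rw [Finset.sum_ite, Finset.sum_const, Finset.sum_const, nsmul_eq_mul, nsmul_eq_mul,
    ← excedances, ← Nat.cast_sub (hcard.le.trans' (Nat.le_add_right _ _)),
    Nat.eq_sub_of_add_eq' hcard]

theorem sum_decomposeFin_symm {n : ℕ} (q : ℝ) (e : Equiv.Perm (Fin n)) :
    ∑ p, C (q ^ cycleNumber (Equiv.Perm.decomposeFin.symm (p, e))) *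
        (X : ℝ[X]) ^ excedances (Equiv.Perm.decomposeFin.symm (p, e)) =
      ((n : ℝ[X]) * X + C q) * (C (q ^ cycleNumber e) * X ^ excedances e) +
        X * (1 - X) * derivative (C (q ^ cycleNumber e) * X ^ excedances e) := by
  have hderiv := mul_derivative_pow (X : ℝ[X]) (excedances e)
  rw [derivative_X, mul_one] at hderiv
  rw [Fin.sum_univ_succ, cycleNumber_decomposeFin_symm_zero, excedances_decomposeFin_symm_zero]
  simp only [cycleNumber_decomposeFin_symm_succ]
  rw [← Finset.mul_sum, sum_X_pow_excedances_decomposeFin_symm_succ, derivative_C_mul,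
    pow_succ q, C_mul]
  linear_combination (-(1 - X) * C (q ^ cycleNumber e)) * hderiv

theorem qEulerian_succ (n : ℕ) (q : ℝ) :
    qEulerian (n + 1) q =
      ((n : ℝ[X]) * X + C q) * qEulerian n q + X * (1 - X) * derivative (qEulerian n q) := by
  rw [qEulerian, ← Equiv.sum_comp Equiv.Perm.decomposeFin.symm, Fintype.sum_prod_type_right,
    Finset.sum_congr rfl fun e _ => sum_decomposeFin_symm q e, Finset.sum_add_distrib,
    ← Finset.mul_sum, ← Finset.mul_sum, ← derivative_sum, qEulerian]

theorem qEulerian_zero (q : ℝ) : qEulerian 0 q = 1 := by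
  simp [qEulerian, cycleNumber, excedances]

theorem qEulerian_one (q : ℝ) : qEulerian 1 q = C q := by
  simpa [qEulerian_zero] using qEulerian_succ 0 q

theorem natDegree_qEulerian_le (n : ℕ) (q : ℝ) : (qEulerian n q).natDegree ≤ n - 1 :=
  natDegree_sum_le_of_forall_le _ _ fun π _ =>
    (natDegree_C_mul_X_pow_le _ _).trans (excedances_le_pred π)

theorem eval_one_qEulerian (n : ℕ) (q : ℝ) :
    (qEulerian n q).eval 1 = ∏ i ∈ Finset.range n, (i + q) := by
  induction n with
  | zero => simp [qEulerian_zero]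
  | succ n ih => simp [qEulerian_succ, ih, Finset.prod_range_succ_comm]

theorem eval_qEulerian_pos (n : ℕ) {q x : ℝ} (hq : 0 < q) (hx : 0 ≤ x) :
    0 < (qEulerian n q).eval x := by
  simp only [qEulerian, eval_finsetSum, eval_mul, eval_C, eval_pow, eval_X]
  refine Finset.sum_pos' (fun π _ => by positivity) ⟨1, Finset.mem_univ _, ?_⟩
  simpa [excedances] using pow_pos hq _

theorem aeval_qEulerian_succ (n : ℕ) (q : ℝ) (z : ℂ) :
    aeval z (qEulerian (n + 1) q) = (n * z + q) * aeval z (qEulerian n q) +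
      z * (1 - z) * aeval z (derivative (qEulerian n q)) := by
  simp [qEulerian_succ]

end Recurrence

section RealZeros

variable {p q : ℝ[X]} {I J : Set ℝ}

theorem aeval_ofReal_eq_zero_iff {x : ℝ} : aeval (x : ℂ) p = 0 ↔ p.IsRoot x := by
  rw [← Complex.coe_algebraMap, aeval_algebraMap_eq_zero_iff, coe_aeval_eq_eval, IsRoot.def]

theorem RZ_C {a : ℝ} (ha : a ≠ 0) (I : Set ℝ) : RZ (C a) I :=
  fun z hz => absurd hz (by simpa using ha)

theorem RZ_X_sub_C {a : ℝ} (ha : a ∈ I) : RZ (X - C a) I :=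
  fun z hz => ⟨a, ha, by simpa [sub_eq_zero] using hz⟩

theorem RZ.mono (h : RZ p I) (hIJ : I ⊆ J) : RZ p J := fun z hz =>
  (h z hz).imp fun _ => And.imp_left (@hIJ _)

theorem RZ.mul (hp : RZ p I) (hq : RZ q I) : RZ (p * q) I := fun z hz =>
  (mul_eq_zero.1 (by rwa [map_mul] at hz)).elim (hp z) (hq z)

theorem RZ.pow (hp : RZ p I) (k : ℕ) : RZ (p ^ k) I := fun z hz =>
  hp z (eq_zero_of_pow_eq_zero (by rwa [map_pow] at hz))

theorem RZ.ne_zero (h : RZ p I) : p ≠ 0 := by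
  rintro rfl
  obtain ⟨x, -, hx⟩ := h Complex.I (by simp)
  simpa using congrArg Complex.im hx

theorem RZ.mem_of_isRoot (h : RZ p I) {x : ℝ} (hx : p.IsRoot x) : x ∈ I := by
  obtain ⟨y, hy, hxy⟩ := h x (aeval_ofReal_eq_zero_iff.2 hx)
  rwa [show x = y from Complex.ofReal_injective hxy]

theorem RZ.mem_of_mem_roots (h : RZ p I) {x : ℝ} (hx : x ∈ p.roots) : x ∈ I :=
  h.mem_of_isRoot (isRoot_of_mem_roots hx)

theorem RZ.splits (h : RZ p I) : p.Splits :=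
  Splits.of_splits_map (algebraMap ℝ ℂ) (IsAlgClosed.splits _) fun z hz => by
    obtain ⟨x, -, rfl⟩ := h z (by simpa [aeval_def, eval_map] using isRoot_of_mem_roots hz)
    exact ⟨x, rfl⟩

end RealZeros

section PartialFractions

/-- The partial fraction `∑ a / (z - b)`, the sum running over the pairs `(a, b)` in `s` of a
residue and a simple pole. -/
noncomputable def partialFraction (s : Multiset (ℝ × ℝ)) (z : ℂ) : ℂ :=
  (s.map fun t => (t.1 : ℂ) / (z - t.2)).sum

theorem partialFraction_cons (t : ℝ × ℝ) (s : Multiset (ℝ × ℝ)) (z : ℂ) :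
    partialFraction (t ::ₘ s) z = t.1 / (z - t.2) + partialFraction s z := by
  simp [partialFraction]

theorem partialFraction_re (s : Multiset (ℝ × ℝ)) (z : ℂ) :
    (partialFraction s z).re =
      (s.map fun t => t.1 * (z.re - t.2) / Complex.normSq (z - t.2)).sum := by
  induction s using Multiset.induction_on with
  | empty => simp [partialFraction]
  | cons t s ih => simp [partialFraction_cons, ih, Complex.div_re]

theorem partialFraction_im (s : Multiset (ℝ × ℝ)) (z : ℂ) :
    (partialFraction s z).im =
      -z.im * (s.map fun t => t.1 / Complex.normSq (z - t.2)).sum := by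
  induction s using Multiset.induction_on with
  | empty => simp [partialFraction]
  | cons t s ih =>
    have hterm : ((t.1 : ℂ) / (z - t.2)).im = -z.im * (t.1 / Complex.normSq (z - t.2)) := by
      simp only [Complex.div_im, Complex.ofReal_im, Complex.ofReal_re, Complex.sub_im]
      ring
    rw [partialFraction_cons, Complex.add_im, hterm, ih, Multiset.map_cons, Multiset.sum_cons,
      mul_add]

variable {s : Multiset (ℝ × ℝ)} {z : ℂ} {c : ℝ}

theorem im_eq_zero_of_partialFraction_eq (hs : ∀ t ∈ s, 0 ≤ t.1) (hc : c ≠ 0)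
    (h : partialFraction s z = c) : z.im = 0 := by
  by_contra hz
  have hsum : (s.map fun t => t.1 / Complex.normSq (z - t.2)).sum = 0 := by
    simpa [h, hz] using partialFraction_im s z
  have hterm : ∀ t ∈ s, t.1 / Complex.normSq (z - t.2) = 0 :=
    Multiset.forall_mem_map_iff.1 <| Multiset.all_zero_of_le_zero_le_of_sum_eq_zero
      (Multiset.forall_mem_map_iff.2 fun t ht => div_nonneg (hs t ht) (Complex.normSq_nonneg _))
      hsum
  have hzero : partialFraction s z = 0 := Multiset.sum_eq_zero <|
    Multiset.forall_mem_map_iff.2 fun t ht => by simpa using hterm t ht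
  exact hc (by exact_mod_cast h.symm.trans hzero)

theorem exists_mem_Ioi_of_partialFraction_eq {L : ℝ} (hs : ∀ t ∈ s, 0 ≤ t.1 ∧ L ≤ t.2)
    (hc : 0 < c) (h : partialFraction s z = c) : ∃ x ∈ Set.Ioi L, z = (x : ℂ) := by
  have hz := im_eq_zero_of_partialFraction_eq (fun t ht => (hs t ht).1) hc.ne' h
  refine ⟨z.re, ?_, Complex.ext rfl (by simpa using hz)⟩
  by_contra hx
  rw [Set.mem_Ioi, not_lt] at hx
  have hre : (partialFraction s z).re ≤ 0 := by
    rw [partialFraction_re]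
    refine (Multiset.sum_le_card_nsmul _ 0 ?_).trans_eq (smul_zero _)
    exact Multiset.forall_mem_map_iff.2 fun t ht => div_nonpos_of_nonpos_of_nonneg
      (mul_nonpos_of_nonneg_of_nonpos (hs t ht).1 (sub_nonpos.2 (hx.trans (hs t ht).2)))
      (Complex.normSq_nonneg _)
  exact hre.not_gt (by simpa [h] using hc)

theorem affine_mul_sum_one_div (u v : ℝ) {s : Multiset ℝ} (hs : ∀ r ∈ s, z ≠ r) :
    (u * z + v) * (s.map fun r : ℝ => 1 / (z - r)).sum =
      u * s.card + partialFraction (s.map fun r => (u * r + v, r)) z := by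
  induction s using Multiset.induction_on with
  | empty => simp [partialFraction]
  | cons r s ih =>
    have hr : z - r ≠ 0 := sub_ne_zero.2 (hs r (Multiset.mem_cons_self r s))
    rw [Multiset.map_cons, Multiset.map_cons, Multiset.sum_cons, partialFraction_cons, mul_add,
      ih fun x hx => hs x (Multiset.mem_cons_of_mem hx), Multiset.card_cons]
    push_cast
    field_simp
    ring

variable {p : ℝ[X]}

theorem affine_mul_aeval_derivative (hp : p.Splits) (hz : aeval z p ≠ 0) (u v : ℝ) :
    (u * z + v) * aeval z (derivative p) =
      aeval z p * (u * p.natDegree + partialFraction (p.roots.map fun r => (u * r + v, r)) z) := by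
  have hlog := (hp.map (algebraMap ℝ ℂ)).eval_derivative_eq_eval_mul_sum (x := z)
    (by rwa [eval_map_algebraMap])
  rw [derivative_map, eval_map_algebraMap, eval_map_algebraMap, hp.roots_map,
    Multiset.map_map] at hlog
  have hne : ∀ r ∈ p.roots, z ≠ r := by
    rintro r hr rfl
    exact hz (aeval_ofReal_eq_zero_iff.2 (isRoot_of_mem_roots hr))
  rw [hp.natDegree_eq_card_roots, ← affine_mul_sum_one_div u v hne, hlog, mul_left_comm]
  rfl

theorem partialFraction_eq_of_mul_aeval_eq (hp : p.Splits) (hz : aeval z p ≠ 0)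
    {u v a b k : ℝ}
    (h : (u * k - a / (z - b)) * aeval z p = (u * z + v) * aeval z (derivative p)) :
    partialFraction ((a, b) ::ₘ p.roots.map fun r => (u * r + v, r)) z =
      ((u * (k - p.natDegree) : ℝ) : ℂ) := by
  rw [affine_mul_aeval_derivative hp hz, mul_comm] at h
  rw [partialFraction_cons]
  push_cast
  linear_combination -mul_left_cancel₀ hz h

theorem RZ.exists_mem_Ioi_of_mul_aeval_eq {L a k : ℝ} (hp : RZ p (Set.Ici L)) (hL : 0 ≤ L)
    (ha : 0 ≤ a) (hk : p.natDegree < k) (hz : aeval z p ≠ 0)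
    (h : (k - a / (z - L)) * aeval z p = z * aeval z (derivative p)) :
    ∃ x ∈ Set.Ioi L, z = (x : ℂ) := by
  have hroots : ∀ r ∈ p.roots, L ≤ r := fun r hr => hp.mem_of_mem_roots hr
  refine exists_mem_Ioi_of_partialFraction_eq ?_ (mul_pos one_pos (sub_pos.2 hk))
    (partialFraction_eq_of_mul_aeval_eq (u := 1) (v := 0) (a := a) (b := L) hp.splits hz
      (by simpa using h))
  rw [Multiset.forall_mem_cons, Multiset.forall_mem_map_iff]
  refine ⟨⟨ha, le_rfl⟩, fun r hr => ⟨?_, hroots r hr⟩⟩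
  simpa using hL.trans (hroots r hr)

end PartialFractions

section Wronskian

variable {R : Type*} [CommRing R]

-- `wronskian f (w * f') / f ^ 2` is the derivative of `w * f' / f`, which is additive in `f`.
theorem wronskian_mul_derivative_mul (w f g : R[X]) :
    wronskian (f * g) (w * derivative (f * g)) =
      f ^ 2 * wronskian g (w * derivative g) + g ^ 2 * wronskian f (w * derivative f) := by
  simp only [wronskian, derivative_mul, derivative_add]
  ring

variable [LinearOrder R] [IsStrictOrderedRing R]

theorem eval_wronskian_prod_X_sub_C_nonneg {c : R} {s : Multiset R} (hs : ∀ r ∈ s, r ≤ c) (x : R) :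
    0 ≤ (wronskian (s.map fun r => X - C r).prod
      ((X - C c) * derivative (s.map fun r => X - C r).prod)).eval x := by
  induction s using Multiset.induction_on with
  | empty => simp [wronskian]
  | cons r s ih =>
    have hlinear : wronskian (X - C r) ((X - C c) * derivative (X - C r)) = C (c - r) := by
      simp [wronskian]
    rw [Multiset.map_cons, Multiset.prod_cons, wronskian_mul_derivative_mul, hlinear]
    simp only [eval_add, eval_mul, eval_pow, eval_C]
    have hr := sub_nonneg.2 (hs r (Multiset.mem_cons_self r s))
    have hs' := ih fun t ht => hs t (Multiset.mem_cons_of_mem ht)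
    positivity

theorem eval_wronskian_nonneg_of_splits {p : R[X]} (hp : p.Splits) {c : R}
    (hc : ∀ r ∈ p.roots, r ≤ c) (x : R) :
    0 ≤ (wronskian p ((X - C c) * derivative p)).eval x := by
  rw [hp.eq_prod_roots, wronskian_mul_derivative_mul]
  simpa [wronskian_zero_right] using
    mul_nonneg (sq_nonneg p.leadingCoeff) (eval_wronskian_prod_X_sub_C_nonneg hc x)

end Wronskian

section PositiveParameter

variable {q : ℝ}

theorem im_eq_zero_of_aeval_qEulerian_succ {n : ℕ} {z : ℂ} (hq : 0 < q)
    (hp : RZ (qEulerian n q) (Set.Iio 0)) (hpz : aeval z (qEulerian n q) ≠ 0)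
    (hz : aeval z (qEulerian (n + 1) q) = 0) : z.im = 0 := by
  rcases eq_or_ne z 0 with rfl | hz0
  · rfl
  rcases n.eq_zero_or_pos with rfl | hn
  · simp [qEulerian_one, hq.ne'] at hz
  have hdegree : ((qEulerian n q).natDegree : ℝ) < n := by
    exact_mod_cast (natDegree_qEulerian_le n q).trans_lt (Nat.pred_lt_self hn)
  refine im_eq_zero_of_partialFraction_eq ?_ (mul_ne_zero (neg_ne_zero.2 one_ne_zero)
    (sub_pos.2 hdegree).ne') (partialFraction_eq_of_mul_aeval_eq (u := -1) (v := 1) (a := q)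
      (b := 0) hp.splits hpz ?_)
  · refine Multiset.forall_mem_cons.2 ⟨hq.le, Multiset.forall_mem_map_iff.2 fun r hr => ?_⟩
    linarith [Set.mem_Iio.1 (hp.mem_of_mem_roots hr)]
  · rw [aeval_qEulerian_succ] at hz
    push_cast
    field_simp
    linear_combination -hz

theorem RZ_Iio_qEulerian (n : ℕ) (hq : 0 < q) : RZ (qEulerian n q) (Set.Iio 0) := by
  induction n with
  | zero => simpa [qEulerian_zero] using RZ_C one_ne_zero (Set.Iio 0)
  | succ n ih =>
    intro z hz
    rcases eq_or_ne (aeval z (qEulerian n q)) 0 with hpz | hpz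
    · exact ih z hpz
    obtain ⟨x, rfl⟩ : ∃ x : ℝ, z = x :=
      ⟨z.re, Complex.ext rfl (im_eq_zero_of_aeval_qEulerian_succ hq ih hpz hz)⟩
    have hroot := aeval_ofReal_eq_zero_iff.1 hz
    exact ⟨x, not_le.1 fun hx => (eval_qEulerian_pos (n + 1) hq hx).ne' hroot, rfl⟩

theorem wronskian_X_mul_qEulerian (n : ℕ) (q : ℝ) :
    wronskian (X * qEulerian n q) (qEulerian (n + 1) q) =
      -(C q * qEulerian n q ^ 2 +
        X ^ 2 * wronskian (qEulerian n q) ((X - C 1) * derivative (qEulerian n q))) := by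
  rw [qEulerian_succ]
  simp only [wronskian, derivative_add, derivative_sub, derivative_mul, derivative_natCast,
    derivative_X, derivative_C, derivative_one, map_one]
  ring

theorem not_isRoot_derivative_qEulerian (n : ℕ) (hq : 0 < q) {x : ℝ}
    (hx : (qEulerian n q).IsRoot x) : ¬ (derivative (qEulerian n q)).IsRoot x := by
  induction n with
  | zero => simp [qEulerian_zero] at hx
  | succ n ih =>
    intro hx'
    have hneg : x < 0 := (RZ_Iio_qEulerian (n + 1) hq).mem_of_isRoot hx
    have hp := RZ_Iio_qEulerian n hq
    have hW := eval_wronskian_nonneg_of_splits hp.splits (c := 1)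
      (fun r hr => (hp.mem_of_mem_roots hr).le.trans zero_le_one) x
    have hroot : (qEulerian n q).IsRoot x := by
      have hWzero : (wronskian (X * qEulerian n q) (qEulerian (n + 1) q)).eval x = 0 := by
        simp [wronskian, hx.eq_zero, hx'.eq_zero]
      rw [wronskian_X_mul_qEulerian] at hWzero
      simp only [eval_neg, eval_add, eval_mul, eval_C, eval_pow, eval_X] at hWzero
      have hsq : (qEulerian n q).eval x ^ 2 ≤ 0 := by
        nlinarith [mul_nonneg (sq_nonneg x) hW]
      exact pow_eq_zero_iff two_ne_zero |>.1 (hsq.antisymm (sq_nonneg _))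
    have hderiv : x * (1 - x) * (derivative (qEulerian n q)).eval x = 0 := by
      simpa [hx.eq_zero, hroot.eq_zero] using (congrArg (eval x) (qEulerian_succ n q)).symm
    refine ih hroot ((mul_eq_zero.1 hderiv).resolve_left ?_)
    exact mul_ne_zero hneg.ne (by linarith)

theorem rootMultiplicity_qEulerian (n : ℕ) (hq : 0 < q) {x : ℝ}
    (hx : (qEulerian n q).IsRoot x) : (qEulerian n q).rootMultiplicity x = 1 := by
  have hne := (RZ_Iio_qEulerian n hq).ne_zero
  refine le_antisymm (not_lt.1 fun h => ?_) ((rootMultiplicity_pos hne).2 hx)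
  exact not_isRoot_derivative_qEulerian n hq hx ((one_lt_rootMultiplicity_iff_isRoot hne).1 h).2

end PositiveParameter

section NonpositiveParameter

variable {n : ℕ} {q : ℝ}

theorem RZ_Ici_qEulerian_succ (h : n + q ≤ 0) (hq : q ≠ 0) :
    RZ (qEulerian (n + 1) q) (Set.Ici 1) := by
  induction n with
  | zero => simpa [qEulerian_one] using RZ_C hq (Set.Ici 1)
  | succ n ih =>
    push_cast at h
    have hp := ih (by linarith)
    intro z hz
    rw [aeval_qEulerian_succ] at hz
    rcases eq_or_ne z 1 with rfl | hz1
    · exact ⟨1, Set.self_mem_Ici, by simp⟩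
    rcases eq_or_ne (aeval z (qEulerian (n + 1) q)) 0 with hpz | hpz
    · exact hp z hpz
    have hdegree : ((qEulerian (n + 1) q).natDegree : ℝ) < (n + 1 : ℕ) := by
      exact_mod_cast Nat.lt_succ_of_le (natDegree_qEulerian_le (n + 1) q)
    refine (hp.exists_mem_Ioi_of_mul_aeval_eq zero_le_one (a := -(n + 1 + q)) (by linarith)
      hdegree hpz ?_).imp fun _ => And.imp_left (@Set.Ioi_subset_Ici_self _ _ _ _)
    have : z - 1 ≠ 0 := sub_ne_zero.2 hz1
    push_cast at hz ⊢
    field_simp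
    linear_combination hz

theorem RZ_Ioi_qEulerian (h : n + q ≤ 0) (hq : q < 0) : RZ (qEulerian n q) (Set.Ioi 1) := by
  have hle : RZ (qEulerian n q) (Set.Ici 1) := by
    rcases n with _ | n
    · simpa [qEulerian_zero] using RZ_C one_ne_zero (Set.Ici 1)
    · exact RZ_Ici_qEulerian_succ (by push_cast at h; linarith) hq.ne
  have hone : (qEulerian n q).eval 1 ≠ 0 := by
    rw [eval_one_qEulerian]
    refine Finset.prod_ne_zero_iff.2 fun i hi => ne_of_lt ?_
    have : (i : ℝ) < n := by exact_mod_cast Finset.mem_range.1 hi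
    linarith
  intro z hz
  obtain ⟨x, hx, rfl⟩ := hle z hz
  refine ⟨x, Set.mem_Ioi.2 (lt_of_le_of_ne hx ?_), rfl⟩
  rintro rfl
  exact hone (aeval_ofReal_eq_zero_iff.1 hz)

end NonpositiveParameter

section NegativeInteger

/-- The operator `k - x d/dx`, by which the cofactor of `(x - 1) ^ (n + q)` in the `n`-th
`q`-Eulerian polynomial evolves when `k = -q` is a positive integer. -/
noncomputable def eulerShift (k : ℝ) (p : ℝ[X]) : ℝ[X] :=
  C k * p - X * derivative p

variable {p : ℝ[X]} {k L : ℝ}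

theorem natDegree_eulerShift_le (k : ℝ) (p : ℝ[X]) :
    (eulerShift k p).natDegree ≤ p.natDegree := by
  have hderiv : (X * derivative p).natDegree ≤ p.natDegree := by
    rcases p.natDegree.eq_zero_or_pos with h | h
    · simp [derivative_of_natDegree_zero h]
    · refine (natDegree_mul_le_of_le natDegree_X_le (natDegree_derivative_le p)).trans ?_
      omega
  exact (natDegree_sub_le _ _).trans (max_le (natDegree_C_mul_le k p) hderiv)

theorem RZ_eulerShift (hp : RZ p (Set.Ioi L)) (hL : 0 ≤ L) (hk : p.natDegree < k) :
    RZ (eulerShift k p) (Set.Ioi L) := by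
  intro z hz
  rcases eq_or_ne (aeval z p) 0 with hpz | hpz
  · exact hp z hpz
  · refine (hp.mono Set.Ioi_subset_Ici_self).exists_mem_Ioi_of_mul_aeval_eq hL le_rfl hk hpz ?_
    simpa [eulerShift, sub_eq_zero] using hz

theorem RZ_iterate_eulerShift (hp : RZ p (Set.Ioi L)) (hL : 0 ≤ L) (hk : p.natDegree < k)
    (j : ℕ) : RZ ((eulerShift k)^[j] p) (Set.Ioi L) := by
  induction j generalizing p with
  | zero => exact hp
  | succ _ ih =>
    exact ih (RZ_eulerShift hp hL hk)
      (hk.trans_le' (by exact_mod_cast natDegree_eulerShift_le k p))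

theorem qEulerian_succ_of_eq_mul {n j : ℕ} {q : ℝ} (h : n + q = j)
    (hp : qEulerian n q = (X - 1) ^ j * p) :
    qEulerian (n + 1) q = (X - 1) ^ (j + 1) * eulerShift (-q) p := by
  have hpow := mul_derivative_pow (X - 1 : ℝ[X]) j
  have hC : (n : ℝ[X]) + C q = j := by
    rw [← C_eq_natCast, ← C_eq_natCast, ← C_add, h]
  rw [derivative_sub, derivative_X, derivative_one, sub_zero, mul_one] at hpow
  rw [qEulerian_succ, hp, derivative_mul, eulerShift, C_neg]
  linear_combination (-X * p) * hpow + (X - 1) ^ j * p * X * hC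

theorem qEulerian_add {m : ℕ} {q : ℝ} (h : m + q = 0) (j : ℕ) :
    qEulerian (m + j) q = (X - 1) ^ j * (eulerShift (-q))^[j] (qEulerian m q) := by
  induction j with
  | zero => simp
  | succ j ih =>
    have hj : ((m + j : ℕ) : ℝ) + q = j := by push_cast; linarith
    rw [Function.iterate_succ_apply', ← add_assoc]
    exact qEulerian_succ_of_eq_mul hj ih

theorem exists_qEulerian_eq_mul (n : ℕ) {k : ℤ} (hk : k < 0) :
    ∃ (m : ℕ) (p : ℝ[X]), (m : ℤ) = max (n + k) 0 ∧ qEulerian n k = (X - 1) ^ m * p ∧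
      RZ p (Set.Ioi 1) := by
  have hk' : (k : ℝ) < 0 := by exact_mod_cast hk
  rcases le_total ((n : ℤ) + k) 0 with hnk | hnk
  · exact ⟨0, qEulerian n k, by simp [hnk], by simp,
      RZ_Ioi_qEulerian (by exact_mod_cast hnk) hk'⟩
  · obtain ⟨a, rfl⟩ : ∃ a : ℕ, k = -a := ⟨k.natAbs, by omega⟩
    obtain ⟨j, rfl⟩ : ∃ j, n = a + j := Nat.exists_eq_add_of_le (by omega)
    have hpos : 0 < a := by omega
    have ha : (a : ℝ) + (-a : ℤ) = 0 := by push_cast; ring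
    have hdegree : ((qEulerian a (-a : ℤ)).natDegree : ℝ) < -(-a : ℤ) := by
      rw [Int.cast_neg, neg_neg]
      exact_mod_cast (natDegree_qEulerian_le a _).trans_lt (Nat.pred_lt_self hpos)
    exact ⟨j, _, by simp, qEulerian_add ha j,
      RZ_iterate_eulerShift (RZ_Ioi_qEulerian ha.le hk') zero_le_one hdegree j⟩

theorem qEulerian_neg_one {n : ℕ} (hn : 1 ≤ n) : qEulerian n (-1) = -(X - 1) ^ (n - 1) := by
  obtain ⟨j, rfl⟩ := Nat.exists_eq_add_of_le hn
  have hfixed : Function.IsFixedPt (eulerShift (- -1)) (C (-1)) := by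
    simp [Function.IsFixedPt, eulerShift]
  rw [qEulerian_add (by norm_num), qEulerian_one, hfixed.iterate j]
  simp

theorem not_X_sub_one_pow_succ_dvd {R : Type*} [CommRing R] [IsDomain R] {p : R[X]}
    (hp : p.eval 1 ≠ 0) (m : ℕ) : ¬ (X - 1) ^ (m + 1) ∣ (X - 1) ^ m * p := by
  have hne : (X - 1 : R[X]) ≠ 0 := by simpa using X_sub_C_ne_zero (1 : R)
  rw [pow_succ, mul_dvd_mul_iff_left (pow_ne_zero m hne), ← C_1, dvd_iff_isRoot]
  exact hp

end NegativeInteger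

theorem proposition2p3 (q : ℝ) (n : ℕ) :
    (0 < q → 2 ≤ n →
      RZ (qEulerian n q) (Set.Iic 0) ∧
        ∀ x : ℝ, (qEulerian n q).IsRoot x → (qEulerian n q).rootMultiplicity x = 1) ∧
    ((n : ℝ) + q ≤ 0 → q ≠ 0 → RZ (qEulerian (n + 1) q) (Set.Ici 1)) ∧
    (∀ k : ℤ, k < 0 → q = (k : ℝ) →
      RZ (qEulerian n q) (Set.Ici 1) ∧
        ∃ m : ℕ, (m : ℤ) = max ((n : ℤ) + k) 0 ∧
          (X - 1) ^ m ∣ qEulerian n q ∧ ¬ (X - 1) ^ (m + 1) ∣ qEulerian n q) ∧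
    (1 ≤ n → qEulerian n (-1) = -(X - 1) ^ (n - 1)) := by
  refine ⟨fun hq _ => ⟨(RZ_Iio_qEulerian n hq).mono Set.Iio_subset_Iic_self,
    fun _ => rootMultiplicity_qEulerian n hq⟩, RZ_Ici_qEulerian_succ, ?_, qEulerian_neg_one⟩
  rintro k hk rfl
  obtain ⟨m, p, hm, hfactor, hp⟩ := exists_qEulerian_eq_mul n hk
  have hone : p.eval 1 ≠ 0 := fun h => Set.self_notMem_Ioi (hp.mem_of_isRoot h)
  rw [hfactor]
  refine ⟨?_, m, hm, dvd_mul_right _ _, not_X_sub_one_pow_succ_dvd hone m⟩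
  exact ((C_1 (R := ℝ) ▸ RZ_X_sub_C Set.self_mem_Ici).pow m).mul (hp.mono Set.Ioi_subset_Ici_self)
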